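/- Let $d$ be a natural number. A SIC in a $d$-dimensional complex Hilbert space is a family of $d^2$ rank-one projectors $\Pi_j=|\psi_j\rangle\langle\psi_j|$ with $|\langle\psi_j|\psi_k\rangle|^2=\frac{d\delta_{jk}+1}{d+1}$ for all $j,k$. Its symmetry group consists of all unitary operators $U$ for which there is a permutation $\sigma$ with $U\Pi_jU^{\dagger}=\Pi_{\sigma(j)}$ for all $j$ (operators that differ by a phase factor being identified); its extended symmetry group consists of all unitary and antiunitary operators with this property. The SIC is $k$-covariant if every ordered $k$-tuple of distinct SIC projectors can be mapped to every other such $k$-tuple by an element of the symmetry group, and $k$-homogeneous if every set of $k$ SIC projectors can be mapped to every other set of $k$ SIC projectors by an element of the symmetry group; it is super-symmetric if it is $2$-covariant. With the extended symmetry group in place of the symmetry group, one speaks of quasi-$k$-covariant, quasi-$k$-homogeneous and quasi-super-symmetric SICs. Then, for every SIC in dimension $d$ and every integer $k$ with $0\le k\leq d^2/2$, the SIC is $k$-covariant if and only if it is $k$-homogeneous, and it is quasi-$k$-covariant if and only if it is quasi-$k$-homogeneous. In particular, in every dimension a SIC is super-symmetric if and only if it is $2$-homogeneous, and it is quasi-super-symmetric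 if and only if it is quasi-$2$-homogeneous. -/

import Mathlib

namespace SIC

variable {H : Type*} [NormedAddCommGroup H] [InnerProductSpace ℂ H] {d : ℕ}

/-- The family `Π` of operators is a SIC (the family of SIC projectors) of a `d`-dimensional
Hilbert space: `Π j = |ψ j⟩⟨ψ j|` for `d ^ 2` vectors `ψ j` with
`|⟨ψ j|ψ k⟩|² = (d δ_{jk} + 1) / (d + 1)`. The case `j = k` says that the `ψ j` are unit vectors. -/
def IsSIC (P : Fin (d ^ 2) → H →L[ℂ] H) : Prop :=
  Module.finrank ℂ H = d ∧
  ∃ ψ : Fin (d ^ 2) → H,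
    (∀ j, P j = InnerProductSpace.rankOne ℂ (ψ j) (ψ j)) ∧
    ∀ j k, ‖inner ℂ (ψ j) (ψ k)‖ ^ 2 = ((d : ℝ) * (if j = k then 1 else 0) + 1) / ((d : ℝ) + 1)

/-- A surjective real-linear isometry that is complex linear is a unitary operator. -/
def IsUnitary (U : H ≃ₗᵢ[ℝ] H) : Prop :=
  ∀ (c : ℂ) (x : H), U (c • x) = c • U x

/-- A surjective real-linear isometry that is conjugate linear is an antiunitary operator. -/
def IsAntiunitary (U : H ≃ₗᵢ[ℝ] H) : Prop :=
  ∀ (c : ℂ) (x : H), U (c • x) = (starRingEnd ℂ) c • U x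

/-- `U Π_j U⁻¹ = Π_{σ j}` for every `j` (and `U⁻¹` is the adjoint of `U`). -/
def Realizes (P : Fin (d ^ 2) → H →L[ℂ] H) (U : H ≃ₗᵢ[ℝ] H) (σ : Equiv.Perm (Fin (d ^ 2))) :
    Prop :=
  ∀ (j : Fin (d ^ 2)) (x : H), U (P j (U.symm x)) = P (σ j) x

theorem isUnitary_one : IsUnitary (1 : H ≃ₗᵢ[ℝ] H) := fun _ _ => rfl

theorem IsUnitary.mul {U V : H ≃ₗᵢ[ℝ] H} (hU : IsUnitary U) (hV : IsUnitary V) :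
    IsUnitary (U * V) := fun c x => by
  rw [LinearIsometryEquiv.coe_mul, Function.comp_apply, Function.comp_apply, hV, hU]

theorem IsUnitary.mul_anti {U V : H ≃ₗᵢ[ℝ] H} (hU : IsUnitary U) (hV : IsAntiunitary V) :
    IsAntiunitary (U * V) := fun c x => by
  rw [LinearIsometryEquiv.coe_mul, Function.comp_apply, Function.comp_apply, hV, hU]

theorem IsAntiunitary.mul_unitary {U V : H ≃ₗᵢ[ℝ] H} (hU : IsAntiunitary U) (hV : IsUnitary V) :
    IsAntiunitary (U * V) := fun c x => by
  rw [LinearIsometryEquiv.coe_mul, Function.comp_apply, Function.comp_apply, hV, hU]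

theorem IsAntiunitary.mul {U V : H ≃ₗᵢ[ℝ] H} (hU : IsAntiunitary U) (hV : IsAntiunitary V) :
    IsUnitary (U * V) := fun c x => by
  rw [LinearIsometryEquiv.coe_mul, Function.comp_apply, Function.comp_apply, hV, hU,
    Complex.conj_conj]

theorem IsUnitary.inv {U : H ≃ₗᵢ[ℝ] H} (hU : IsUnitary U) : IsUnitary U⁻¹ := fun c x => by
  apply U.injective
  rw [hU]
  change U (U.symm _) = c • U (U.symm _)
  simp

theorem IsAntiunitary.inv {U : H ≃ₗᵢ[ℝ] H} (hU : IsAntiunitary U) : IsAntiunitary U⁻¹ :=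
  fun c x => by
    apply U.injective
    rw [hU]
    change U (U.symm _) = _ • U (U.symm _)
    simp

theorem realizes_one (P : Fin (d ^ 2) → H →L[ℂ] H) : Realizes P 1 1 := fun _ _ => rfl

theorem Realizes.mul {P : Fin (d ^ 2) → H →L[ℂ] H} {U V : H ≃ₗᵢ[ℝ] H}
    {σ τ : Equiv.Perm (Fin (d ^ 2))} (hU : Realizes P U σ) (hV : Realizes P V τ) :
    Realizes P (U * V) (σ * τ) := fun j x => by
  have h := hU (τ j) x
  rw [← hV j (U.symm x)] at h
  exact h

theorem Realizes.inv {P : Fin (d ^ 2) → H →L[ℂ] H} {U : H ≃ₗᵢ[ℝ] H}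
    {σ : Equiv.Perm (Fin (d ^ 2))} (hU : Realizes P U σ) : Realizes P U⁻¹ σ⁻¹ := fun j x => by
  have h := hU (σ⁻¹ j) (U x)
  rw [LinearIsometryEquiv.symm_apply_apply, ← Equiv.Perm.mul_apply, mul_inv_cancel,
    Equiv.Perm.one_apply] at h
  change U.symm (P j (U x)) = _
  rw [← h, LinearIsometryEquiv.symm_apply_apply]

/-- The symmetry group: the unitary operators that permute the SIC projectors. -/
def symmetryGroup (P : Fin (d ^ 2) → H →L[ℂ] H) : Subgroup (H ≃ₗᵢ[ℝ] H) where
  carrier := {U | IsUnitary U ∧ ∃ σ, Realizes P U σ}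
  one_mem' := ⟨isUnitary_one, 1, realizes_one P⟩
  mul_mem' := by
    rintro U V ⟨hU, σ, hσ⟩ ⟨hV, τ, hτ⟩
    exact ⟨hU.mul hV, σ * τ, hσ.mul hτ⟩
  inv_mem' := by
    rintro U ⟨hU, σ, hσ⟩
    exact ⟨hU.inv, σ⁻¹, hσ.inv⟩

/-- The extended symmetry group: the unitary and antiunitary operators that permute the SIC
projectors. -/
def extendedSymmetryGroup (P : Fin (d ^ 2) → H →L[ℂ] H) : Subgroup (H ≃ₗᵢ[ℝ] H) where
  carrier := {U | (IsUnitary U ∨ IsAntiunitary U) ∧ ∃ σ, Realizes P U σ}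
  one_mem' := ⟨Or.inl isUnitary_one, 1, realizes_one P⟩
  mul_mem' := by
    rintro U V ⟨hU, σ, hσ⟩ ⟨hV, τ, hτ⟩
    refine ⟨?_, σ * τ, hσ.mul hτ⟩
    rcases hU with hU | hU <;> rcases hV with hV | hV
    · exact Or.inl (hU.mul hV)
    · exact Or.inr (hU.mul_anti hV)
    · exact Or.inr (hU.mul_unitary hV)
    · exact Or.inl (hU.mul hV)
  inv_mem' := by
    rintro U ⟨hU, σ, hσ⟩
    exact ⟨hU.imp IsUnitary.inv IsAntiunitary.inv, σ⁻¹, hσ.inv⟩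

/-- The permutation group that a group `G` of operators induces on the SIC projectors. Operators
that differ by a phase factor induce the same permutation, so that identifying such operators
makes no difference here. -/
def inducedPerms (P : Fin (d ^ 2) → H →L[ℂ] H) (G : Subgroup (H ≃ₗᵢ[ℝ] H)) :
    Subgroup (Equiv.Perm (Fin (d ^ 2))) where
  carrier := {σ | ∃ U ∈ G, Realizes P U σ}
  one_mem' := ⟨1, G.one_mem, realizes_one P⟩
  mul_mem' := by
    rintro σ τ ⟨U, hU, hσ⟩ ⟨V, hV, hτ⟩
    exact ⟨U * V, G.mul_mem hU hV, hσ.mul hτ⟩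
  inv_mem' := by
    rintro σ ⟨U, hU, hσ⟩
    exact ⟨U⁻¹, G.inv_mem hU, hσ.inv⟩

/-- Every ordered `k`-tuple of distinct SIC projectors can be mapped to every other such tuple by
an element of the symmetry group. -/
def IsCovariant (P : Fin (d ^ 2) → H →L[ℂ] H) (k : ℕ) : Prop :=
  MulAction.IsMultiplyPretransitive (inducedPerms P (symmetryGroup P)) (Fin (d ^ 2)) k

/-- The same with the extended symmetry group. -/
def IsQuasiCovariant (P : Fin (d ^ 2) → H →L[ℂ] H) (k : ℕ) : Prop :=
  MulAction.IsMultiplyPretransitive (inducedPerms P (extendedSymmetryGroup P)) (Fin (d ^ 2)) k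

/-- Every unordered `k`-tuple of distinct SIC projectors, that is, every set of `k` of them, can be
mapped to every other such set by an element of the symmetry group. -/
def IsHomogeneous (P : Fin (d ^ 2) → H →L[ℂ] H) (k : ℕ) : Prop :=
  MulAction.IsPretransitive (inducedPerms P (symmetryGroup P)) (Set.powersetCard (Fin (d ^ 2)) k)

/-- The same with the extended symmetry group. -/
def IsQuasiHomogeneous (P : Fin (d ^ 2) → H →L[ℂ] H) (k : ℕ) : Prop :=
  MulAction.IsPretransitive (inducedPerms P (extendedSymmetryGroup P))
    (Set.powersetCard (Fin (d ^ 2)) k)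

/-- Super-symmetric means doubly covariant. -/
def IsSuperSymmetric (P : Fin (d ^ 2) → H →L[ℂ] H) : Prop := IsCovariant P 2

/-- Quasi-super-symmetric means quasi-doubly covariant. -/
def IsQuasiSuperSymmetric (P : Fin (d ^ 2) → H →L[ℂ] H) : Prop := IsQuasiCovariant P 2

end SIC

/-! Transitivity always implies homogeneity, and the converse is immediate for `k = 0, 1`. For `k =
2` it is a parity argument: the number of pairs from `d ^ 2` points is even, so a 2-homogeneous
group contains an involution, which reverses some pair; conjugating through that pair reverses every
pair.

For `k ≥ 3` the bound on `k` forces `d ≥ 3`, and homogeneity is impossible. By Gottlieb's theorem,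
`k`-homogeneity makes every invariant function on 3-subsets constant. Real parts of the triple
products `⟨ψ i|ψ j⟩⟨ψ j|ψ k⟩⟨ψ k|ψ i⟩` give such a function, invariant even under antiunitaries, so
they would all equal some `r`. With `G ^ 2 = d G` for the Gram matrix, the imaginary parts of the
triple products through a fixed point `e` become differences of a function on points. They also have
constant square, so on three points they must vanish, and comparing moduli gives a polynomial
equation in `d` with no solution for `d ≥ 3`. -/

/-! ### Inclusion matrices and invariant functions on subsets -/

/-- A function on finsets that is invariant under exchanging one point for another takes the
same value on all subsets of `X` of equal size. -/
theorem Finset.eq_of_exchange {α β : Type*} [DecidableEq α] {X : Finset α} {j : ℕ}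
    {f : Finset α → β}
    (h : ∀ x ∈ X, ∀ y ∈ X, ∀ U ⊆ X, U.card = j → x ∉ U → y ∉ U → f (insert x U) = f (insert y U))
    {T T' : Finset α} (hT : T ⊆ X) (hT' : T' ⊆ X) (hTc : T.card = j + 1)
    (hTc' : T'.card = j + 1) : f T = f T' := by
  induction hm : (T \ T').card generalizing T with
  | zero =>
    have : T ⊆ T' := by simpa using hm
    rw [Finset.eq_of_subset_of_card_le this (by omega)]
  | succ m ih =>
    obtain ⟨x, hx⟩ : (T \ T').Nonempty := by rw [← Finset.card_pos]; omega
    obtain ⟨y, hy⟩ : (T' \ T).Nonempty := by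
      rw [← Finset.card_pos, Finset.card_sdiff_comm (hTc'.trans hTc.symm)]; omega
    rw [Finset.mem_sdiff] at hx hy
    have hU : (T.erase x).card = j := by rw [Finset.card_erase_of_mem hx.1]; omega
    have hyU : y ∉ T.erase x := fun hh => hy.2 (Finset.mem_of_mem_erase hh)
    have hUX : T.erase x ⊆ X := (Finset.erase_subset _ _).trans hT
    rw [← Finset.insert_erase hx.1, h x (hT hx.1) y (hT' hy.1) _ hUX hU (by simp) hyU]
    refine ih (Finset.insert_subset (hT' hy.1) hUX) (by rw [Finset.card_insert_of_notMem hyU, hU])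
      ?_
    have : insert y (T.erase x) \ T' = (T \ T').erase x := by
      ext z
      simp only [Finset.mem_sdiff, Finset.mem_insert, Finset.mem_erase]
      constructor
      · rintro ⟨rfl | h1, h2⟩
        · exact absurd hy.1 h2
        · exact ⟨h1.1, h1.2, h2⟩
      · rintro ⟨h1, h2, h3⟩
        exact ⟨Or.inr ⟨h1, h2⟩, h3⟩
    rw [this, Finset.card_erase_of_mem (Finset.mem_sdiff.2 hx), hm]
    rfl

theorem Finset.sum_powersetCard_insert {α β : Type*} [DecidableEq α] [AddCommMonoid β]
    {R : Finset α} {x : α} (hx : x ∉ R) (j : ℕ) (f : Finset α → β) :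
    ∑ T ∈ (insert x R).powersetCard (j + 1), f T =
      ∑ T ∈ R.powersetCard (j + 1), f T + ∑ U ∈ R.powersetCard j, f (insert x U) := by
  rw [Finset.powersetCard_succ_insert hx, Finset.sum_union, Finset.sum_image]
  · intro U hU V hV h
    have hxU : x ∉ U := fun hh => hx ((Finset.mem_powersetCard.1 hU).1 hh)
    have hxV : x ∉ V := fun hh => hx ((Finset.mem_powersetCard.1 hV).1 hh)
    rw [← Finset.erase_insert hxU, ← Finset.erase_insert hxV]
    exact congrArg (fun s => s.erase x) h
  · rw [Finset.disjoint_left]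
    intro T hT hT'
    obtain ⟨U, -, rfl⟩ := Finset.mem_image.1 hT'
    exact hx ((Finset.mem_powersetCard.1 hT).1 (Finset.mem_insert_self x U))

/-- The inclusion matrix of `j`-subsets against `k`-subsets of `X` has trivial kernel when
`j ≤ k` and `j + k ≤ |X|` (Gottlieb). -/
theorem Finset.eq_zero_of_sum_powersetCard_eq_zero {α : Type*} [DecidableEq α] (j : ℕ) :
    ∀ (k : ℕ) (X : Finset α) (f : Finset α → ℝ), j ≤ k → j + k ≤ X.card →
      (∀ S ⊆ X, S.card = k → ∑ T ∈ S.powersetCard j, f T = 0) →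
      ∀ T ⊆ X, T.card = j → f T = 0 := by
  induction j with
  | zero =>
    intro k X f _ hX h T _ hT
    obtain ⟨S, hS, hSc⟩ := Finset.exists_subset_card_eq (s := X) (n := k) (by omega)
    rw [Finset.card_eq_zero.1 hT]
    simpa using h S hS hSc
  | succ j ih =>
    intro k X f hjk hX h T hT hTc
    obtain ⟨k, rfl⟩ : ∃ k', k = k' + 1 := ⟨k - 1, by omega⟩
    have exch : ∀ x ∈ X, ∀ y ∈ X, ∀ U ⊆ X, U.card = j → x ∉ U → y ∉ U →
        f (insert x U) = f (insert y U) := by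
      intro x hx y hy U hU hUc hxU hyU
      rcases eq_or_ne x y with rfl | hxy
      · rfl
      -- The difference is a function on `j`-subsets of `X \ {x, y}` with vanishing sums over
      -- `k`-subsets `R`: subtract the hypotheses for `R ∪ {x}` and `R ∪ {y}`; the terms avoiding
      -- both points cancel.
      refine sub_eq_zero.1 (ih k ((X.erase x).erase y)
        (fun U => f (insert x U) - f (insert y U)) (by omega) ?_ ?_ U ?_ hUc)
      · rw [Finset.card_erase_of_mem (by simp [hy, hxy.symm]), Finset.card_erase_of_mem hx]
        omega
      · intro R hR hRc
        have hxR : x ∉ R := fun hh => by simpa using hR hh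
        have hyR : y ∉ R := fun hh => by simpa using hR hh
        have hRX : R ⊆ X := fun z hz => Finset.mem_of_mem_erase (Finset.mem_of_mem_erase (hR hz))
        have h1 := h (insert x R) (Finset.insert_subset hx hRX)
          (by rw [Finset.card_insert_of_notMem hxR, hRc])
        have h2 := h (insert y R) (Finset.insert_subset hy hRX)
          (by rw [Finset.card_insert_of_notMem hyR, hRc])
        rw [Finset.sum_powersetCard_insert hxR] at h1
        rw [Finset.sum_powersetCard_insert hyR] at h2
        rw [Finset.sum_sub_distrib]
        linarith
      · intro z hz
        simp only [Finset.mem_erase]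
        exact ⟨fun e => hyU (e ▸ hz), fun e => hxU (e ▸ hz), hU hz⟩
    obtain ⟨S, hTS, hS, hSc⟩ := Finset.exists_subsuperset_card_eq (n := k + 1) hT (by omega)
      (by omega)
    have hsum := h S hS hSc
    rw [Finset.sum_congr rfl (g := fun _ => f T), Finset.sum_const, Finset.card_powersetCard,
      hSc, nsmul_eq_mul, mul_eq_zero] at hsum
    · refine hsum.resolve_left ?_
      exact_mod_cast (Nat.choose_pos hjk).ne'
    · intro T' hT'
      rw [Finset.mem_powersetCard] at hT'
      exact Finset.eq_of_exchange exch (hT'.1.trans hS) hT hT'.2 hTc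

open scoped Pointwise in
/-- A function on `j`-subsets that is invariant under a `k`-homogeneous group is constant. -/
theorem MulAction.eq_of_isPretransitive_powersetCard {α G : Type*} [DecidableEq α] [Fintype α]
    [Group G] [MulAction G α] {j k : ℕ} (hjk : j ≤ k) (hk : j + k ≤ Fintype.card α)
    [h : MulAction.IsPretransitive G (Set.powersetCard α k)] {f : Finset α → ℝ}
    (hf : ∀ (g : G) (T : Finset α), f (g • T) = f T) {T T' : Finset α} (hT : T.card = j)
    (hT' : T'.card = j) : f T = f T' := by
  obtain ⟨S₀, -, hS₀⟩ := Finset.exists_subset_card_eq (s := (Finset.univ : Finset α)) (n := k)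
    (by rw [Finset.card_univ]; omega)
  set F : Finset α → ℝ := fun S => ∑ T ∈ S.powersetCard j, f T with hF
  have hFinv : ∀ (g : G) (S : Finset α), F (g • S) = F S := by
    intro g S
    have : g • S = S.map (MulAction.toPerm g).toEmbedding := by
      rw [Finset.map_eq_image]; rfl
    simp only [hF]
    rw [this, Finset.powersetCard_map, Finset.sum_map]
    refine Finset.sum_congr rfl fun U _ => ?_
    rw [← hf g U]
    congr 1
    exact Finset.map_eq_image _ _
  have hconst : ∀ S : Finset α, S.card = k → F S = F S₀ := by
    intro S hS
    obtain ⟨g, hg⟩ := h.exists_smul_eq (Set.powersetCard.ofCard hS₀) (Set.powersetCard.ofCard hS)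
    have hg' : g • S₀ = S := congrArg Subtype.val hg
    rw [← hg', hFinv]
  have hC : ((k.choose j : ℕ) : ℝ) ≠ 0 := by exact_mod_cast (Nat.choose_pos hjk).ne'
  -- Subtracting the average of `f` over the `j`-subsets of a `k`-set puts it in the kernel of the
  -- inclusion matrix.
  have key := Finset.eq_zero_of_sum_powersetCard_eq_zero j k Finset.univ
    (fun T => f T - F S₀ / k.choose j) hjk (by rwa [Finset.card_univ]) (by
      intro S _ hS
      rw [Finset.sum_sub_distrib, Finset.sum_const, Finset.card_powersetCard, hS, nsmul_eq_mul,
        mul_div_cancel₀ _ hC, ← hconst S hS, sub_self])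
  have h1 := key T (Finset.subset_univ _) hT
  have h2 := key T' (Finset.subset_univ _) hT'
  linarith

/-! ### Pairs and involutions -/

/-- A `2`-homogeneous permutation group on a set with an even number of pairs is `2`-transitive:
it contains an involution. -/
theorem MulAction.isMultiplyPretransitive_two_of_even {α : Type*} [DecidableEq α] [Fintype α]
    {K : Subgroup (Equiv.Perm α)} (h : MulAction.IsPretransitive K (Set.powersetCard α 2))
    (heven : Even ((Fintype.card α).choose 2)) : MulAction.IsMultiplyPretransitive K α 2 := by
  rw [MulAction.is_two_pretransitive_iff]
  have move : ∀ {a b c d : α}, a ≠ b → c ≠ d →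
      ∃ g : K, (g • a = c ∧ g • b = d) ∨ (g • a = d ∧ g • b = c) := by
    intro a b c d hab hcd
    obtain ⟨g, hg⟩ := h.exists_smul_eq (Set.powersetCard.ofCard (Finset.card_pair hab))
      (Set.powersetCard.ofCard (Finset.card_pair hcd))
    have hg' : ({a, b} : Finset α).image (fun x => g • x) = {c, d} := congrArg Subtype.val hg
    rw [Finset.image_insert, Finset.image_singleton] at hg'
    refine ⟨g, ?_⟩
    have := congrArg (fun s : Finset α => (s : Set α)) hg'
    simp only [Finset.coe_insert, Finset.coe_singleton] at this
    exact Set.pair_eq_pair_iff.1 this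
  intro a b c d hab hcd
  have hne : Nonempty (Set.powersetCard α 2) :=
    ⟨Set.powersetCard.ofCard (Finset.card_pair hab)⟩
  have hdvd : 2 ∣ Nat.card K := by
    have h1 : Nat.card (Set.powersetCard α 2) ∣ Nat.card K := by
      obtain ⟨x⟩ := hne
      rw [← MulAction.index_stabilizer_of_transitive K x]
      exact Subgroup.index_dvd_card _
    rw [Set.powersetCard.card, Nat.card_eq_fintype_card] at h1
    exact heven.two_dvd.trans h1
  obtain ⟨s, hs⟩ := exists_prime_orderOf_dvd_card' 2 hdvd
  have hs1 : s ≠ 1 := fun e => by simp [e] at hs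
  have hss : s * s = 1 := by rw [← sq, ← hs, pow_orderOf_eq_one]
  obtain ⟨x, hx⟩ : ∃ x : α, s • x ≠ x := by
    by_contra! hall
    exact hs1 (Subtype.ext (Equiv.ext hall))
  have hsx : s • s • x = x := by rw [smul_smul, hss, one_smul]
  -- Route `(a, b)` to `(c, d)` through the pair `{s • x, x}`, inserting `s` exactly when one of
  -- `p`, `q` has the wrong orientation.
  obtain ⟨p, hp⟩ := move hab hx.symm
  obtain ⟨q, hq⟩ := move hx.symm hcd
  rcases hp with ⟨hp1, hp2⟩ | ⟨hp1, hp2⟩ <;> rcases hq with ⟨hq1, hq2⟩ | ⟨hq1, hq2⟩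
  · exact ⟨q * p, by rw [mul_smul, hp1, hq1], by rw [mul_smul, hp2, hq2]⟩
  · exact ⟨q * s * p, by rw [mul_smul, mul_smul, hp1, hq2],
      by rw [mul_smul, mul_smul, hp2, hsx, hq1]⟩
  · exact ⟨q * s * p, by rw [mul_smul, mul_smul, hp1, hsx, hq1],
      by rw [mul_smul, mul_smul, hp2, hq2]⟩
  · exact ⟨q * p, by rw [mul_smul, hp1, hq2], by rw [mul_smul, hp2, hq1]⟩

/-- A square is 0 or 1 modulo 4, so 4 divides one of `d ^ 2` and `d ^ 2 - 1`. -/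
theorem Nat.even_choose_two_sq (d : ℕ) : Even ((d ^ 2).choose 2) := by
  have key : 4 ∣ d ^ 2 * (d ^ 2 - 1) := by
    rcases Nat.even_or_odd' d with ⟨m, rfl | rfl⟩
    · exact Dvd.dvd.mul_right ⟨m ^ 2, by ring⟩ _
    · refine Dvd.dvd.mul_left ⟨m ^ 2 + m, ?_⟩ _
      rw [Nat.sub_eq_iff_eq_add (Nat.one_le_pow _ _ (by omega))]
      ring
  rw [Nat.choose_two_right]
  obtain ⟨c, hc⟩ := key
  rw [hc]
  exact ⟨c, by omega⟩

/-! ### The Gram matrix of a SIC -/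

open scoped ComplexConjugate Matrix ComplexOrder

/-- The vectors of a SIC have norm one. -/
theorem SIC.inner_self_eq_one {H : Type*} [NormedAddCommGroup H] [InnerProductSpace ℂ H]
    {d : ℕ} {ψ : Fin (d ^ 2) → H}
    (hψ : ∀ j k, ‖inner ℂ (ψ j) (ψ k)‖ ^ 2 =
      ((d : ℝ) * (if j = k then 1 else 0) + 1) / ((d : ℝ) + 1)) (i : Fin (d ^ 2)) :
    inner ℂ (ψ i) (ψ i) = 1 := by
  have hd1 : (d : ℝ) + 1 ≠ 0 := by positivity
  have h1 := hψ i i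
  rw [if_pos rfl, mul_one, div_self hd1, inner_self_eq_norm_sq_to_K] at h1
  have h2 : ‖ψ i‖ ^ 4 = 1 := by
    rw [← h1]; simp; ring
  rw [inner_self_eq_norm_sq_to_K, (pow_eq_one_iff_of_nonneg (norm_nonneg _) (by norm_num)).1 h2]
  simp

/-- The Gram matrix `G` of the vectors of a SIC satisfies `G ^ 2 = d G`. -/
theorem SIC.sum_inner_mul_inner {H : Type*} [NormedAddCommGroup H] [InnerProductSpace ℂ H]
    [FiniteDimensional ℂ H] {d : ℕ} {ψ : Fin (d ^ 2) → H} (hd : Module.finrank ℂ H = d)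
    (hψ : ∀ j k, ‖inner ℂ (ψ j) (ψ k)‖ ^ 2 =
      ((d : ℝ) * (if j = k then 1 else 0) + 1) / ((d : ℝ) + 1)) (i j : Fin (d ^ 2)) :
    ∑ k, inner ℂ (ψ i) (ψ k) * inner ℂ (ψ k) (ψ j) = d * inner ℂ (ψ i) (ψ j) := by
  have hd1 : (d : ℝ) + 1 ≠ 0 := by positivity
  let b : OrthonormalBasis (Fin d) ℂ H := (stdOrthonormalBasis ℂ H).reindex (finCongr hd)
  let M : Matrix (Fin d) (Fin (d ^ 2)) ℂ := Matrix.of fun a i => inner ℂ (b a) (ψ i)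
  have hG : ∀ i j, (Mᴴ * M) i j = inner ℂ (ψ i) (ψ j) := by
    intro i j
    rw [← b.sum_inner_mul_inner (ψ i) (ψ j), Matrix.mul_apply]
    simp [M]
  have htr : (M * Mᴴ).trace = (d : ℂ) ^ 2 := by
    rw [Matrix.trace_mul_comm]
    have : ∀ i, (Mᴴ * M) i i = 1 := by
      intro i
      rw [hG, SIC.inner_self_eq_one hψ]
    simp [Matrix.trace, this]
  have htr2 : (M * Mᴴ * (M * Mᴴ)).trace = (d : ℂ) ^ 3 := by
    rw [Matrix.mul_assoc, Matrix.trace_mul_comm, Matrix.mul_assoc, Matrix.mul_assoc,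
      ← Matrix.mul_assoc Mᴴ M]
    have h2 : ∀ i j, (Mᴴ * M) i j * (Mᴴ * M) j i =
        (((d : ℝ) * (if i = j then 1 else 0) + 1) / ((d : ℝ) + 1) : ℝ) := by
      intro i j
      rw [hG, hG, ← inner_conj_symm (ψ j) (ψ i), Complex.mul_conj, ← hψ i j,
        Complex.normSq_eq_norm_sq]
    simp only [Matrix.trace, Matrix.diag_apply]
    simp_rw [Matrix.mul_apply (M := Mᴴ * M), h2]
    rw [← Complex.ofReal_natCast, ← Complex.ofReal_pow]
    simp_rw [← Complex.ofReal_sum]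
    congr 1
    simp_rw [← Finset.sum_div, Finset.sum_add_distrib, ← Finset.mul_sum]
    simp
    field_simp
    ring
  -- The SIC vectors form a tight frame: the squared Frobenius norm of this difference is `d ^ 3 - 2
  -- d * d ^ 2 + d ^ 2 * d = 0`.
  have hS : M * Mᴴ - (d : ℂ) • (1 : Matrix (Fin d) (Fin d) ℂ) = 0 := by
    rw [← Matrix.trace_conjTranspose_mul_self_eq_zero_iff]
    have hH : (M * Mᴴ - (d : ℂ) • (1 : Matrix (Fin d) (Fin d) ℂ))ᴴ =
        M * Mᴴ - (d : ℂ) • (1 : Matrix (Fin d) (Fin d) ℂ) := by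
      simp [Matrix.conjTranspose_sub, Matrix.conjTranspose_smul]
    rw [hH]
    simp only [Matrix.sub_mul, Matrix.mul_sub, Matrix.trace_sub, htr2, Matrix.smul_mul,
      Matrix.mul_smul, Matrix.one_mul, Matrix.mul_one, Matrix.trace_smul, htr, Matrix.trace_one,
      Fintype.card_fin, smul_eq_mul]
    ring
  have hGG : Mᴴ * M * (Mᴴ * M) = (d : ℂ) • (Mᴴ * M) := by
    rw [Matrix.mul_assoc, ← Matrix.mul_assoc M, sub_eq_zero.1 hS]
    simp
  have := congrFun (congrFun hGG i) j
  simpa [Matrix.mul_apply (M := Mᴴ * M), hG] using this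

/-- A Hermitian matrix `G` of size `d ^ 2` with `d ≥ 3`, unit diagonal, off-diagonal entries of
squared modulus `1 / (d + 1)` and `G ^ 2 = d G` has triple products with different real parts. -/
theorem SIC.not_re_triple_const {ι : Type*} [Fintype ι] [DecidableEq ι] {d : ℕ} (hd : 3 ≤ d)
    (hι : Fintype.card ι = d ^ 2) {G : ι → ι → ℂ} (hherm : ∀ i j, conj (G i j) = G j i)
    (hdiag : ∀ i, G i i = 1) (hoff : ∀ i j, i ≠ j → G i j * G j i = ((1 / (d + 1) : ℝ) : ℂ))
    (hsq : ∀ i j, ∑ k, G i k * G k j = d * G i j) (r : ℝ) :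
    ¬ ∀ i j k, i ≠ j → j ≠ k → i ≠ k → (G i j * G j k * G k i).re = r := by
  intro hr
  have hd' : (3 : ℝ) ≤ d := by exact_mod_cast hd
  set A : ℝ := 1 / (d + 1) with hA
  have hApos : 0 < A := by positivity
  have hA1 : A * (d + 1) = 1 := by rw [hA]; field_simp
  have hcard : 4 ≤ Fintype.card ι := by rw [hι]; nlinarith
  obtain ⟨e, i, j, k, hei, hej, hek, hij, hik, hjk⟩ : ∃ e i j k : ι,
      e ≠ i ∧ e ≠ j ∧ e ≠ k ∧ i ≠ j ∧ i ≠ k ∧ j ≠ k := by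
    obtain ⟨φ⟩ := Function.Embedding.nonempty_of_card_le (α := Fin 4) (β := ι) (by simpa)
    refine ⟨φ 0, φ 1, φ 2, φ 3, ?_⟩
    simp [φ.injective.ne_iff]
  let T : ι → ι → ℂ := fun i j => G e i * G i j * G j e
  have hT : ∀ i j, T i j = G e i * G i j * G j e := fun _ _ => rfl
  -- the common real part
  have hrval : ((d : ℝ) ^ 2 - 2) * r = (d - 2) * A := by
    -- This row sum of `T` comes from `G ^ 2 = d G`. The terms `k = e` and `k = i` equal `A`, and
    -- the other `d ^ 2 - 2` have real part `r`.
    have h1 : ∑ k, T i k = ((d * A : ℝ) : ℂ) := by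
      simp only [hT, mul_assoc, ← Finset.mul_sum]
      rw [hsq, mul_left_comm, hoff _ _ hei]
      push_cast; ring
    have h2 := congrArg Complex.re h1
    rw [Complex.re_sum, Complex.ofReal_re, ← Finset.add_sum_erase _ _ (Finset.mem_univ e),
      ← Finset.add_sum_erase _ _ (a := i) (by simp [hei.symm]),
      Finset.sum_congr rfl (g := fun _ => r), Finset.sum_const, Finset.card_erase_of_mem,
      Finset.card_erase_of_mem, Finset.card_univ, hι] at h2
    · have h3 : T i e = A := by rw [hT, hdiag, mul_one, hoff _ _ hei]
      have h4 : T i i = A := by rw [hT, hdiag, mul_one, hoff _ _ hei]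
      have h5 : ((d ^ 2 - 1 - 1 : ℕ) : ℝ) = (d : ℝ) ^ 2 - 2 := by
        rw [Nat.sub_sub, Nat.cast_sub (by nlinarith)]; push_cast; ring
      rw [h3, h4, nsmul_eq_mul, h5] at h2
      simp only [Complex.ofReal_re] at h2
      linarith
    · simp
    · simp [hei.symm]
    · intro k hk
      simp only [Finset.mem_erase, Finset.mem_univ, and_true] at hk
      exact hr _ _ _ hei hk.1.symm hk.2.symm
  have hr0 : r ≠ 0 := by
    rintro rfl
    have : 0 < (d - 2) * A := mul_pos (by linarith) hApos
    linarith
  -- squared imaginary parts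
  have hre : ∀ i j, e ≠ i → e ≠ j → i ≠ j → (T i j).re = r :=
    fun i j h1 h2 h3 => hr _ _ _ h1 h3 h2
  have hTconj : ∀ i j, conj (T i j) = T j i := by
    intro i j
    simp only [hT, map_mul, hherm]
    ring
  have him : ∀ i j, e ≠ i → e ≠ j → i ≠ j → (T i j).im ^ 2 = A ^ 3 - r ^ 2 := by
    intro i j h1 h2 h3
    have h4 : T i j * conj (T i j) = ((A ^ 3 : ℝ) : ℂ) := by
      rw [hTconj]
      push_cast
      calc T i j * T j i = (G e i * G i e) * (G i j * G j i) * (G j e * G e j) := by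
            simp only [hT]; ring
        _ = (A : ℂ) ^ 3 := by rw [hoff _ _ h1, hoff _ _ h3, hoff _ _ h2.symm]; ring
    rw [Complex.mul_conj, Complex.ofReal_inj, Complex.normSq_apply, hre _ _ h1 h2 h3] at h4
    linarith
  have hanti : ∀ i j, (T j i).im = - (T i j).im := by
    intro i j
    rw [← hTconj, Complex.conj_im]
  have hTe : ∀ i, (T i e).im = 0 := by
    intro i
    have h : T i e = ((Complex.normSq (G e i) : ℝ) : ℂ) := by
      rw [hT, hdiag, mul_one, ← hherm e i, Complex.mul_conj]
    rw [h, Complex.ofReal_im]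
  -- the imaginary part of `T ^ 2`
  have key : ∀ i j, e ≠ i → e ≠ j → i ≠ j →
      ∑ k, (T i k).im - ∑ k, (T j k).im = (d : ℝ) ^ 2 * (T i j).im := by
    intro i j h1 h2 h3
    have hTii : T i i = A := by rw [hT, hdiag, mul_one, hoff _ _ h1]
    have hTjj : T j j = A := by rw [hT, hdiag, mul_one, hoff _ _ h2]
    -- The factor `G k e * G e k` is `A` except at `k = e`, where it is 1. Hence `T ^ 2` is `A d T`
    -- up to a real correction, invisible to imaginary parts.
    have hk : ∀ k, T i k * T k j = (A : ℂ) * (G e i * (G i k * G k j) * G j e) +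
        if k = e then ((1 - A) * A * A : ℂ) else 0 := by
      intro k
      split_ifs with hke
      · subst hke
        have a1 := hoff _ _ h1
        have a2 := hoff _ _ h2
        calc T i k * T k j = (G k i * G i k) * (G k j * G j k) * (G k k * G k k) := by
              simp only [hT]; ring
          _ = A * A := by rw [a1, a2, hdiag]; ring
          _ = A * ((G k i * G i k) * (G k j * G j k)) + (1 - A) * A * A := by
              rw [a1, a2]; ring
          _ = _ := by ring
      · have a1 := hoff k e hke
        calc T i k * T k j = (G k e * G e k) * (G e i * (G i k * G k j) * G j e) := by
              simp only [hT]; ring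
          _ = _ := by rw [a1, add_zero]
    have hsum : ∑ k, T i k * T k j = ((A * d : ℝ) : ℂ) * T i j + (((1 - A) * A * A : ℝ) : ℂ) := by
      rw [Finset.sum_congr rfl fun k _ => hk k, Finset.sum_add_distrib, ← Finset.mul_sum,
        ← Finset.sum_mul, ← Finset.mul_sum, hsq, Finset.sum_ite_eq', if_pos (Finset.mem_univ e)]
      simp only [hT]; push_cast; ring
    have hsumim := congrArg Complex.im hsum
    rw [Complex.im_sum, Complex.add_im, Complex.ofReal_im, Complex.im_ofReal_mul, add_zero]
      at hsumim
    -- For generic `k` both factors have real part `r`, and antisymmetry of the imaginary part gives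
    -- the difference. At `k = i` or `k = j` one factor is the real number `A` in place of `r`.
    have hkim : ∀ k, (T i k * T k j).im = r * ((T i k).im - (T j k).im) +
        ((if k = i then (A - r) * (T i j).im else 0) +
          if k = j then (A - r) * (T i j).im else 0) := by
      intro k
      rw [Complex.mul_im, hanti j k]
      rcases eq_or_ne k e with rfl | hke
      · rw [if_neg h1, if_neg h2, hTe, hTe]; ring
      rcases eq_or_ne k i with rfl | hki
      · rw [if_pos rfl, if_neg h3, hTii, hanti k j]; simp; ring
      rcases eq_or_ne k j with rfl | hkj
      · rw [if_neg hki, if_pos rfl, hTjj]; simp; ring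
      rw [if_neg hki, if_neg hkj, hre _ _ h1 hke.symm hki.symm, hre _ _ hke.symm h2 hkj]
      ring
    rw [Finset.sum_congr rfl fun k _ => hkim k, Finset.sum_add_distrib, ← Finset.mul_sum,
      Finset.sum_sub_distrib, Finset.sum_add_distrib, Finset.sum_ite_eq', Finset.sum_ite_eq',
      if_pos (Finset.mem_univ i), if_pos (Finset.mem_univ j)] at hsumim
    refine mul_left_cancel₀ hr0 ?_
    linear_combination hsumim - (T i j).im * hrval
  -- three points
  have k1 := key i j hei hej hij
  have k2 := key j k hej hek hjk
  have k3 := key i k hei hek hik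
  have m1 := him i j hei hej hij
  have m2 := him j k hej hek hjk
  have m3 := him i k hei hek hik
  have hsum3 : (T i j).im + (T j k).im = (T i k).im := by
    have : (d : ℝ) ^ 2 ≠ 0 := by positivity
    refine mul_left_cancel₀ this ?_
    linarith
  -- If `x`, `y` and `x + y` all have square `Y`, then `2xy = -Y`, so `Y ^ 2 = 4 Y ^ 2` and `Y = 0`.
  have hY : A ^ 3 = r ^ 2 := by
    rw [← hsum3] at m3
    have hxy : 2 * ((T i j).im * (T j k).im) = -(A ^ 3 - r ^ 2) := by linarith
    have h4 : (2 * ((T i j).im * (T j k).im)) ^ 2 = 4 * (A ^ 3 - r ^ 2) ^ 2 := by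
      rw [mul_pow, mul_pow, m1, m2]; ring
    rw [hxy] at h4
    have : (A ^ 3 - r ^ 2) ^ 2 = 0 := by linarith
    have := pow_eq_zero_iff (two_ne_zero) |>.1 this
    linarith
  have hN : ((d : ℝ) ^ 2 - 2) ^ 2 = (d - 2) ^ 2 * (d + 1) := by
    have h1 : ((d : ℝ) ^ 2 - 2) ^ 2 * A ^ 3 = (d - 2) ^ 2 * A ^ 2 := by
      rw [hY, ← mul_pow, hrval]; ring
    have h2 : A ^ 2 * (((d : ℝ) ^ 2 - 2) ^ 2 * A) = A ^ 2 * (d - 2) ^ 2 := by linarith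
    have h3 := mul_left_cancel₀ (pow_ne_zero 2 hApos.ne') h2
    rw [← h3, mul_assoc, hA1, mul_one]
  nlinarith [mul_pos (show (0 : ℝ) < d - 2 by linarith) (show (0 : ℝ) < d - 2 by linarith),
    sq_nonneg ((d : ℝ) ^ 2 - 2), mul_nonneg (sq_nonneg ((d : ℝ) - 2)) (show (0 : ℝ) ≤ d - 3 by linarith)]

/-! ### Triple products as invariants of the extended symmetry group -/

open scoped Pointwise

namespace SIC

variable {H : Type*} [NormedAddCommGroup H] [InnerProductSpace ℂ H] {d : ℕ}

/-- The real trace of a product of three operators is twice the real part of its complex trace. -/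
noncomputable def realTriple (P : Fin (d ^ 2) → H →L[ℂ] H) (i j k : Fin (d ^ 2)) : ℝ :=
  LinearMap.trace ℝ H (((P i ∘L P j ∘L P k : H →L[ℂ] H) : H →ₗ[ℂ] H).restrictScalars ℝ)

/-- The trace over `ℝ` is invariant under conjugation by any real-linear isometry, so unitaries and
antiunitaries need no separate treatment; an antiunitary would conjugate the complex trace. -/
theorem realTriple_perm {P : Fin (d ^ 2) → H →L[ℂ] H} {U : H ≃ₗᵢ[ℝ] H}
    {σ : Equiv.Perm (Fin (d ^ 2))} (hU : Realizes P U σ) (i j k : Fin (d ^ 2)) :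
    realTriple P (σ i) (σ j) (σ k) = realTriple P i j k := by
  rw [realTriple, realTriple]
  refine Eq.trans ?_ (LinearMap.trace_conj' _ U.toLinearEquiv)
  congr 1
  ext x
  simp [LinearEquiv.conj_apply, ← hU _ _]

/-- The product of projectors factors through `ℂ`. Swapping the two factors under the trace leaves
multiplication by the triple product on `ℂ`, whose real trace is twice the real part. -/
theorem realTriple_eq [FiniteDimensional ℂ H] {P : Fin (d ^ 2) → H →L[ℂ] H}
    {ψ : Fin (d ^ 2) → H}
    (hP : ∀ j, P j = InnerProductSpace.rankOne ℂ (ψ j) (ψ j)) (i j k : Fin (d ^ 2)) :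
    realTriple P i j k =
      2 * (inner ℂ (ψ i) (ψ j) * inner ℂ (ψ j) (ψ k) * inner ℂ (ψ k) (ψ i)).re := by
  have : FiniteDimensional ℝ H := FiniteDimensional.complexToReal H
  let f : ℂ →ₗ[ℝ] H := (LinearMap.toSpanSingleton ℂ H
    ((inner ℂ (ψ i) (ψ j) * inner ℂ (ψ j) (ψ k)) • ψ i)).restrictScalars ℝ
  let g : H →ₗ[ℝ] ℂ := (innerSL ℂ (ψ k) : H →ₗ[ℂ] ℂ).restrictScalars ℝ
  have hfg : ((P i ∘L P j ∘L P k : H →L[ℂ] H) : H →ₗ[ℂ] H).restrictScalars ℝ = f ∘ₗ g := by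
    ext x
    simp [f, g, hP, smul_smul]
    ring_nf
  rw [realTriple, hfg, LinearMap.trace_comp_comm', ← Algebra.trace_complex_apply,
    Algebra.trace_apply]
  congr 1
  refine LinearMap.ext fun z => ?_
  simp only [f, g, LinearMap.comp_apply, LinearMap.restrictScalars_apply,
    LinearMap.toSpanSingleton_apply, ContinuousLinearMap.coe_coe, innerSL_apply_apply,
    inner_smul_right, Algebra.coe_lmul_eq_mul, LinearMap.mul_apply']
  ring

/-- The real parts of the triple products in a set of indices, summed. -/
noncomputable def tripleSum (P : Fin (d ^ 2) → H →L[ℂ] H) (T : Finset (Fin (d ^ 2))) : ℝ :=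
  ∑ i ∈ T, ∑ j ∈ T, ∑ k ∈ T, realTriple P i j k

theorem tripleSum_map {P : Fin (d ^ 2) → H →L[ℂ] H} {U : H ≃ₗᵢ[ℝ] H}
    {σ : Equiv.Perm (Fin (d ^ 2))} (hU : Realizes P U σ) (T : Finset (Fin (d ^ 2))) :
    tripleSum P (σ • T) = tripleSum P T := by
  have : σ • T = T.map σ.toEmbedding := by rw [Finset.map_eq_image]; rfl
  simp [tripleSum, this, realTriple_perm hU]

/-- For `d ≥ 3` and `3 ≤ k ≤ d ^ 2 - 3`, no group of isometries permuting the projectors of a SIC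
is `k`-homogeneous. -/
theorem IsSIC.not_isPretransitive_powersetCard [FiniteDimensional ℂ H]
    {P : Fin (d ^ 2) → H →L[ℂ] H} (hP : IsSIC P) (hd : 3 ≤ d)
    {K : Subgroup (Equiv.Perm (Fin (d ^ 2)))} (hK : ∀ σ ∈ K, ∃ U, Realizes P U σ) {k : ℕ}
    (hk : 3 ≤ k) (hkd : 3 + k ≤ d ^ 2) :
    ¬ MulAction.IsPretransitive K (Set.powersetCard (Fin (d ^ 2)) k) := by
  intro hpre
  obtain ⟨hfin, ψ, hPψ, hψ⟩ := hP
  have hconst : ∀ {T T' : Finset (Fin (d ^ 2))}, T.card = 3 → T'.card = 3 →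
      tripleSum P T = tripleSum P T' := by
    refine MulAction.eq_of_isPretransitive_powersetCard (G := K) (h := hpre) hk
      (by simpa using hkd) ?_
    rintro ⟨σ, hσ⟩ T
    obtain ⟨U, hU⟩ := hK σ hσ
    exact tripleSum_map hU T
  let G : Fin (d ^ 2) → Fin (d ^ 2) → ℂ := fun i j => inner ℂ (ψ i) (ψ j)
  have hherm : ∀ i j, starRingEnd ℂ (G i j) = G j i := fun i j => inner_conj_symm _ _
  have hdiag : ∀ i, G i i = 1 := inner_self_eq_one hψ
  have hoff : ∀ i j, i ≠ j → G i j * G j i = ((1 / (d + 1) : ℝ) : ℂ) := by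
    intro i j hij
    have h1 := hψ i j
    rw [if_neg hij, mul_zero, zero_add] at h1
    rw [← hherm i j, Complex.mul_conj, Complex.normSq_eq_norm_sq, h1]
  -- Of the 27 terms, the 6 orderings of `i, j, k` share one real part (cyclic shifts preserve the
  -- product, reversal conjugates it), 3 have all indices equal, and 18 have exactly two equal.
  have hval : ∀ i j k, i ≠ j → j ≠ k → i ≠ k → tripleSum P {i, j, k} =
      12 * (G i j * G j k * G k i).re + 6 + 36 * (1 / (d + 1)) := by
    intro i j k hij hjk hik
    have e : ∀ i j k, realTriple P i j k = 2 * (G i j * G j k * G k i).re :=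
      realTriple_eq hPψ
    have e3 : ∀ i, realTriple P i i i = 2 := fun i => by simp [e, hdiag]
    have e1 : ∀ i j, i ≠ j → realTriple P i i j = 2 * (1 / (d + 1)) := fun i j h => by
      rw [e, hdiag, one_mul, hoff _ _ h, Complex.ofReal_re]
    have e2 : ∀ i j, i ≠ j → realTriple P i j i = 2 * (1 / (d + 1)) := fun i j h => by
      rw [e, hdiag, mul_one, hoff _ _ h, Complex.ofReal_re]
    have e2' : ∀ i j, i ≠ j → realTriple P j i i = 2 * (1 / (d + 1)) := fun i j h => by
      rw [e, hdiag, mul_one, hoff _ _ h.symm, Complex.ofReal_re]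
    have hcyc : ∀ i j k, realTriple P j k i = realTriple P i j k := fun i j k => by
      rw [e, e]
      ring_nf
    have hrev : ∀ i j k, realTriple P k j i = realTriple P i j k := fun i j k => by
      rw [e, e, ← Complex.conj_re (G i j * G j k * G k i), map_mul, map_mul, hherm, hherm, hherm]
      ring_nf
    have c1 := hcyc i j k
    have c2 := hcyc j k i
    have c3 := hrev i j k
    have c4 := hcyc k j i
    have c5 := hcyc j i k
    have s1 : i ∉ ({j, k} : Finset (Fin (d ^ 2))) := by simp [hij, hik]
    have s2 : j ∉ ({k} : Finset (Fin (d ^ 2))) := by simp [hjk]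
    simp only [tripleSum, Finset.sum_insert s1, Finset.sum_insert s2, Finset.sum_singleton, e3,
      e1 _ _ hij, e1 _ _ hij.symm, e1 _ _ hjk, e1 _ _ hjk.symm, e1 _ _ hik, e1 _ _ hik.symm,
      e2 _ _ hij, e2 _ _ hij.symm, e2 _ _ hjk, e2 _ _ hjk.symm, e2 _ _ hik, e2 _ _ hik.symm,
      e2' _ _ hij, e2' _ _ hij.symm, e2' _ _ hjk, e2' _ _ hjk.symm, e2' _ _ hik,
      e2' _ _ hik.symm]
    linarith [e i j k]
  obtain ⟨r, hr⟩ : ∃ r : ℝ, ∀ i j k, i ≠ j → j ≠ k → i ≠ k → (G i j * G j k * G k i).re = r := by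
    by_cases h : ∃ T : Finset (Fin (d ^ 2)), T.card = 3
    · obtain ⟨T, hT⟩ := h
      refine ⟨(tripleSum P T - 6 - 36 * (1 / (d + 1))) / 12, fun i j k hij hjk hik => ?_⟩
      rw [hconst hT (Finset.card_eq_three.2 ⟨i, j, k, hij, hik, hjk, rfl⟩), hval i j k hij hjk hik]
      ring
    · exact ⟨0, fun i j k hij hjk hik =>
        absurd ⟨{i, j, k}, Finset.card_eq_three.2 ⟨i, j, k, hij, hik, hjk, rfl⟩⟩ h⟩
  exact not_re_triple_const hd (by simp) hherm hdiag hoff (sum_inner_mul_inner hfin hψ) r hr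

/-! ### Transitivity versus homogeneity -/

/-- Only the number of points matters here, so the case `k = 2` holds in every dimension, without
the bound on `k`. -/
theorem isMultiplyPretransitive_two_iff (K : Subgroup (Equiv.Perm (Fin (d ^ 2)))) :
    MulAction.IsMultiplyPretransitive K (Fin (d ^ 2)) 2 ↔
      MulAction.IsPretransitive K (Set.powersetCard (Fin (d ^ 2)) 2) :=
  ⟨Set.powersetCard.isPretransitive_of_isMultiplyPretransitive K, fun h =>
    MulAction.isMultiplyPretransitive_two_of_even h (by simpa using Nat.even_choose_two_sq d)⟩

/-- For a group of isometries permuting the projectors of a SIC, `k`-transitivity and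
`k`-homogeneity agree. -/
theorem IsSIC.isMultiplyPretransitive_iff [FiniteDimensional ℂ H]
    {P : Fin (d ^ 2) → H →L[ℂ] H} (hP : IsSIC P)
    {K : Subgroup (Equiv.Perm (Fin (d ^ 2)))} (hK : ∀ σ ∈ K, ∃ U, Realizes P U σ) {k : ℕ}
    (hk : 2 * k ≤ d ^ 2) : MulAction.IsMultiplyPretransitive K (Fin (d ^ 2)) k ↔
      MulAction.IsPretransitive K (Set.powersetCard (Fin (d ^ 2)) k) := by
  refine ⟨Set.powersetCard.isPretransitive_of_isMultiplyPretransitive K, fun h => ?_⟩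
  match k with
  | 0 => exact MulAction.is_zero_pretransitive'
  | 1 =>
    rw [MulAction.is_one_pretransitive_iff]
    refine ⟨fun a b => ?_⟩
    obtain ⟨g, hg⟩ := h.exists_smul_eq (Set.powersetCard.ofSingleton a)
      (Set.powersetCard.ofSingleton b)
    exact ⟨g, (Set.powersetCard.mulActionHom_singleton_bijective K (Fin (d ^ 2))).1 hg⟩
  | 2 => exact (isMultiplyPretransitive_two_iff K).2 h
  | k + 3 =>
    -- For `d ≤ 2` there are at most 4 points, too few for `k ≥ 3`.
    have hd : 3 ≤ d := by
      by_contra! hlt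
      have : d ^ 2 ≤ 2 ^ 2 := Nat.pow_le_pow_left (by omega) 2
      omega
    have : 3 ^ 2 ≤ d ^ 2 := Nat.pow_le_pow_left hd 2
    exact absurd h (hP.not_isPretransitive_powersetCard hd hK (by omega) (by omega))

theorem exists_realizes_of_mem_inducedPerms {P : Fin (d ^ 2) → H →L[ℂ] H}
    {G : Subgroup (H ≃ₗᵢ[ℝ] H)} : ∀ σ ∈ inducedPerms P G, ∃ U, Realizes P U σ :=
  fun _ ⟨U, _, hU⟩ => ⟨U, hU⟩

end SIC

theorem mainTheorem6 {H : Type*} [NormedAddCommGroup H] [InnerProductSpace ℂ H]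
    [FiniteDimensional ℂ H] (d : ℕ) (P : Fin (d ^ 2) → H →L[ℂ] H) (hP : SIC.IsSIC P) :
    (∀ k : ℕ, (k : ℝ) ≤ (d : ℝ) ^ 2 / 2 →
      (SIC.IsCovariant P k ↔ SIC.IsHomogeneous P k) ∧
      (SIC.IsQuasiCovariant P k ↔ SIC.IsQuasiHomogeneous P k)) ∧
    (SIC.IsSuperSymmetric P ↔ SIC.IsHomogeneous P 2) ∧
    (SIC.IsQuasiSuperSymmetric P ↔ SIC.IsQuasiHomogeneous P 2) := by
  refine ⟨fun k hk => ?_, SIC.isMultiplyPretransitive_two_iff _,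
    SIC.isMultiplyPretransitive_two_iff _⟩
  have hk' : 2 * k ≤ d ^ 2 := by
    have : (2 : ℝ) * k ≤ (d : ℝ) ^ 2 := by linarith
    exact_mod_cast this
  exact ⟨hP.isMultiplyPretransitive_iff SIC.exists_realizes_of_mem_inducedPerms hk',
    hP.isMultiplyPretransitive_iff SIC.exists_realizes_of_mem_inducedPerms hk'⟩
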